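/- **Setting.** Let $\mathbb F_q$ be a finite field, $\mathcal C$ an $[n,k]$ linear code over $\mathbb F_q$ ($k\ge 1$) with $k\times n$ generator matrix $G$, and $V=(v_{i,m})\in\mathbb F_q^{\mu\times f}$ a nonzero matrix. An *information set* of $\mathcal C$ is a set $I\subseteq[n]$ of size $k$ such that $G|_I$ is invertible. The code is *MDS-PIR capacity-achieving* if for some $\kappa$ and some $\nu\ge1$ with $\frac{\kappa}{\nu}=\frac kn$ there is a binary $\nu\times n$ matrix all of whose columns have Hamming weight $\kappa$ and all of whose row supports contain an information set. Independent messages $W^{(1)},\dots,W^{(f)}$, each a $\beta\times k$ matrix ($\beta\ge 1$ arbitrary) of independent uniform symbols of $\mathbb F_q$, are stored on $n$ databases: database $j$ stores $C_j$, the $j$-th columns of $W^{(1)}G,\dots,W^{(f)}G$. The candidate function evaluations are $X^{(v)}=\sum_{m=1}^f v_{v,m}W^{(m)}$, $v\in[\mu]$. All random variables below are discrete and all entropies are in $q$-ary units. A *private linear computation (PLC) protocol* consists of queries $Q^{(v)}_j$ and answers $A^{(v)}_j$ ($v\in[\mu]$, $j\in[n]$) such that, for all $v,v'\in[\mu]$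 and $j\in[n]$: - $(Q^{(v)}_1,\dots,Q^{(v)}_n)$ is independent of the messages $(W^{(1)},\dots,W^{(f)})$; - $H(A^{(v)}_j\mid Q^{(v)}_j,C_j)=0$; - (privacy) $(Q^{(v)}_j,A^{(v)}_j,X^{(1)},\dots,X^{(\mu)})$ and $(Q^{(v')}_j,A^{(v')}_j,X^{(1)},\dots,X^{(\mu)})$ are identically distributed; - (recovery) $H(X^{(v)}\mid A^{(v)}_1,\dots,A^{(v)}_n,Q^{(v)}_1,\dots,Q^{(v)}_n)=0$. The rate of the protocol is $\mathsf L\,\mathsf H_{\min}/\mathsf D$, where $\mathsf L=\beta k$, $\mathsf H_{\min}$ is the minimum over $v\in[\mu]$ of the entropy of a single symbol of $X^{(v)}$, and $\mathsf D=\sum_{j=1}^nH(A^{(v)}_j)$ is the download cost (by privacy it is the same for all $v$). The PLC capacity $\mathsf C_{\mathrm{PLC}}$ is the supremum of the rates of all PLC protocols (over all $\beta$). **Theorem.** If $\mathcal C$ is MDS-PIR capacity-achieving and $r=\operatorname{rank}V\ge1$, then $$\mathsf C_{\mathrm{PLC}}\le\frac{1}{1+\sum_{v=1}^{r-1}\left(\frac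 kn\right)^v},$$ and for $k<n$ the right-hand side equals $\left(1-\frac kn\right)\left[1-\left(\frac kn\right)^r\right]^{-1}$. -/

import Mathlib

open scoped ENNReal

universe u w

noncomputable section

namespace PLC

/-! ### Shannon entropy of discrete random variables -/

section Entropy

universe u₁ u₂ u₃

variable {Ω : Type u₁} {S : Type u₂} {T : Type u₃}

/-- Shannon entropy (in `q`-ary units) of the random variable `X` on the discrete probability
space `(Ω, P)`: `H(X) = ∑ₓ p(x) log_q (1 / p(x))`, possibly infinite. -/
def entropy (q : ℕ) (P : PMF Ω) (X : Ω → S) : ℝ≥0∞ :=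
  ∑' x : S, ENNReal.ofReal (Real.negMulLog ((P.map X) x).toReal / Real.log q)

/-- Conditional Shannon entropy (in `q`-ary units)
`H(X | Y) = ∑_{x,y} p(x,y) log_q (p(y) / p(x,y))`, possibly infinite. All summands are
nonnegative, because `p(x,y) ≤ p(y)`. -/
def condEntropy (q : ℕ) (P : PMF Ω) (X : Ω → S) (Y : Ω → T) : ℝ≥0∞ :=
  ∑' z : S × T, ENNReal.ofReal
    (((P.map fun ω => (X ω, Y ω)) z).toReal *
      Real.log (((P.map Y) z.2).toReal / ((P.map fun ω => (X ω, Y ω)) z).toReal) / Real.log q)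

/-- Independence of two discrete random variables: the joint probability mass function is the
product of the marginal ones. -/
def Indep (P : PMF Ω) (X : Ω → S) (Y : Ω → T) : Prop :=
  ∀ x y, (P.map fun ω => (X ω, Y ω)) (x, y) = (P.map X) x * (P.map Y) y

end Entropy

/-! ### Storage codes -/

section Codes

variable {F : Type w} [Field F] {n k : ℕ}

/-- `I ⊆ [n]` is an information set of the code with `k × n` generator matrix `G`: it has
size `k`, and the square submatrix `G|_I` is invertible. -/
def IsInformationSet (G : Matrix (Fin k) (Fin n) F) (I : Finset (Fin n)) : Prop :=
  ∃ e : Fin k ≃ I, IsUnit (G.submatrix id fun i => (e i : Fin n))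

/-- The binary `ν × n` matrix `Λ` is a PIR achievable rate matrix with parameters `(κ, ν)` for
the code generated by `G`: every column has Hamming weight `κ`, and the support of every row
contains an information set. -/
def IsPIRAchievableRateMatrix (G : Matrix (Fin k) (Fin n) F) (κ ν : ℕ)
    (Λ : Matrix (Fin ν) (Fin n) Bool) : Prop :=
  (∀ j, (Finset.univ.filter fun i => Λ i j = true).card = κ) ∧
    ∀ i, ∃ I : Finset (Fin n), IsInformationSet G I ∧ ∀ j ∈ I, Λ i j = true

/-- The code generated by `G` is MDS-PIR capacity-achieving: it has a PIR achievable rate matrix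
with `κ / ν = k / n`. -/
def IsMDSPIRCapacityAchieving (G : Matrix (Fin k) (Fin n) F) : Prop :=
  ∃ (κ ν : ℕ) (Λ : Matrix (Fin ν) (Fin n) Bool),
    0 < ν ∧ IsPIRAchievableRateMatrix G κ ν Λ ∧ (κ : ℚ) / ν = (k : ℚ) / n

end Codes

/-! ### The storage system and the candidate functions -/

section System

variable {F : Type w} [Field F] {n k f μ β : ℕ}

/-- The symbols `(C⁽ᵐ⁾_{i,j})_{m, i}` stored on the `j`-th database: row `i` of message `m` is
encoded into row `i` of `W⁽ᵐ⁾ G`. -/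
def stored (G : Matrix (Fin k) (Fin n) F) (W : Fin f → Fin β → Fin k → F) (j : Fin n) :
    Fin f → Fin β → F :=
  fun m i => ∑ l, W m i l * G l j

/-- The evaluation `X⁽ᵛ⁾` of the `v`-th candidate function, symbol by symbol: its symbol at
position `(i, l)` is `∑ₘ V_{v,m} W⁽ᵐ⁾_{i,l}`. -/
def evaluation (V : Matrix (Fin μ) (Fin f) F) (W : Fin f → Fin β → Fin k → F) (v : Fin μ) :
    Fin β → Fin k → F :=
  fun i l => ∑ m, V v m * W m i l

/-- `H_min`, the least entropy (in `q`-ary units, `q = |F|`) of one symbol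
`X⁽ᵛ⁾ = ∑ₘ V_{v,m} w_m` of a candidate function evaluation, where `w` is uniform on `F^f`. -/
def Hmin [Fintype F] (V : Matrix (Fin μ) (Fin f) F) : ℝ≥0∞ :=
  ⨅ v : Fin μ, entropy (Fintype.card F) (PMF.uniformOfFintype (Fin f → F))
    (fun w => ∑ m, V v m * w m)

end System

/-! ### Protocols, rate and capacity -/

variable {F : Type w} [Field F] [Fintype F] {n k f μ : ℕ}

/-- A private linear computation protocol for `f` messages stored with generator matrix `G` and
for the candidate linear functions given by the rows of `V`. -/
structure Protocol (G : Matrix (Fin k) (Fin n) F) (V : Matrix (Fin μ) (Fin f) F) where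
  /-- The number of rows of each message. -/
  β : ℕ
  β_pos : 0 < β
  /-- The underlying discrete probability space. -/
  Ω : Type u
  P : PMF Ω
  /-- The alphabet of the queries. -/
  QAlph : Type u
  /-- The alphabet of the answers. -/
  AAlph : Type u
  /-- The `f` messages, each a random `β × k` matrix. -/
  W : Ω → Fin f → Fin β → Fin k → F
  /-- `Q v j` is the query to database `j` when function `v` is desired. -/
  Q : Fin μ → Fin n → Ω → QAlph
  /-- `A v j` is the answer of database `j` when function `v` is desired. -/
  A : Fin μ → Fin n → Ω → AAlph
  /-- The messages are independent, with independent uniform symbols. -/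
  uniform : P.map W = PMF.uniformOfFintype (Fin f → Fin β → Fin k → F)
  /-- The queries are generated without knowledge of the messages. -/
  indep : ∀ v, Indep P (fun ω j => Q v j ω) W
  /-- Each answer is determined by the query and the data stored on the database. -/
  answer : ∀ v j, condEntropy (Fintype.card F) P (A v j) (fun ω => (Q v j ω, stored G (W ω) j)) = 0
  /-- Privacy against each single database. -/
  privacy : ∀ v v' j, P.map (fun ω => (Q v j ω, A v j ω, evaluation V (W ω))) =
    P.map (fun ω => (Q v' j ω, A v' j ω, evaluation V (W ω)))
  /-- The desired function evaluation is determined by all answers and queries. -/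
  recovery : ∀ v, condEntropy (Fintype.card F) P (fun ω => evaluation V (W ω) v)
    (fun ω => ((fun j => A v j ω), (fun j => Q v j ω))) = 0

variable {G : Matrix (Fin k) (Fin n) F} {V : Matrix (Fin μ) (Fin f) F}

/-- The total download cost `D = ∑ⱼ H(Aⱼ⁽ᵛ⁾)` in `q`-ary units. By privacy it does not depend on
the desired index `v`. -/
def Protocol.downloadCost (S : Protocol.{u} G V) (v : Fin μ) : ℝ≥0∞ :=
  ∑ j, entropy (Fintype.card F) S.P (S.A v j)

/-- The rate `L · H_min / D` with `L = β k`. -/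
def Protocol.rate (S : Protocol.{u} G V) (v : Fin μ) : ℝ≥0∞ :=
  ((S.β * k : ℕ) : ℝ≥0∞) * Hmin V / S.downloadCost v

/-- The capacity: the supremum of the rates of all protocols, over all message sizes. -/
def capacity (G : Matrix (Fin k) (Fin n) F) (V : Matrix (Fin μ) (Fin f) F) : ℝ≥0∞ :=
  ⨆ (S : Protocol.{u} G V) (v : Fin μ), S.rate v

end PLC

end

namespace PLC

/-! ### Entropy of functions of a uniform random element of a finite type -/

section UniformEntropy

variable {U U' S S' S'' : Type*} [Fintype U] [Fintype U']

/-! Fix a value of the queries that has positive probability. By independence the messages remain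
uniform, so every conditional entropy becomes a count of fibres on the finite set of messages.
Choose r linearly independent rows of `V`, and let T(t) be the sum over databases of H(A_j | Q_j,
first t chosen evaluations). T(t) sees one database at a time, so privacy makes it independent of
the desired function (`Protocol.totalEntropy_eq`). Desire the next chosen function. Subadditivity
bounds T(t) below by the joint entropy of all answers. Recovery extracts βk log q from it and adds
that function to the conditioning (`Protocol.answersEntropy_succ`). The remaining joint entropy is
at least (k/n) T(t+1): contents on an information set are independent
(`IsInformationSet.sum_uniformCondEntropy_le`), and averaging over the rate matrix gives the factor
k/n (`IsMDSPIRCapacityAchieving.div_mul_sum_le`). Hence T(t) ≥ βk log q + (k/n) T(t+1). Iterating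
from T(r) ≥ 0 gives a geometric sum below T(0), while T(0) ≤ D log q and H_min ≤ 1. -/

open Classical in
/-- The number of points of `U` at which `X` takes the value `s`. -/
noncomputable def fiberCard (X : U → S) (s : S) : ℕ := (Finset.univ.filter fun u => X u = s).card

/-- The entropy, in natural units, of `X u` for `u` uniform on the finite type `U`. -/
noncomputable def uniformEntropy (X : U → S) : ℝ :=
  (∑ u, Real.log (Fintype.card U / fiberCard X (X u))) / Fintype.card U

/-- The conditional entropy, in natural units, of `X u` given `Y u` for `u` uniform on `U`. -/
noncomputable def uniformCondEntropy (X : U → S) (Y : U → S') : ℝ :=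
  uniformEntropy (fun u => (X u, Y u)) - uniformEntropy Y

lemma fiberCard_pos (X : U → S) (u : U) : 0 < fiberCard X (X u) := by
  classical
  exact Finset.card_pos.2 ⟨u, by simp⟩

lemma fiberCard_le (X : U → S) (s : S) : fiberCard X s ≤ Fintype.card U := by
  classical
  exact Finset.card_le_univ _

lemma uniformEntropy_nonneg (X : U → S) : 0 ≤ uniformEntropy X := by
  refine div_nonneg (Finset.sum_nonneg fun u _ => Real.log_nonneg ?_) (Nat.cast_nonneg _)
  have : (0 : ℝ) < fiberCard X (X u) := by exact_mod_cast fiberCard_pos X u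
  rw [one_le_div this]
  exact_mod_cast fiberCard_le X _

lemma uniformEntropy_mono {X : U → S} {Y : U → S'} (h : ∀ u u', X u = X u' → Y u = Y u') :
    uniformEntropy Y ≤ uniformEntropy X := by
  classical
  unfold uniformEntropy
  gcongr with u
  · have h1 : (0 : ℝ) < fiberCard Y (Y u) := by exact_mod_cast fiberCard_pos Y u
    have : (0 : ℝ) < Fintype.card U := by
      exact_mod_cast Fintype.card_pos_iff.2 ⟨u⟩
    positivity
  · exact_mod_cast fiberCard_pos X u
  · exact Finset.card_le_card fun u' hu' => by
      simp only [Finset.mem_filter, Finset.mem_univ, true_and] at hu' ⊢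
      exact h _ _ hu'

/-- Entropy depends only on the partition into fibres, so variables can be re-encoded in any
codomain. -/
lemma uniformEntropy_congr {X : U → S} {Y : U → S'} (h : ∀ u u', X u = X u' ↔ Y u = Y u') :
    uniformEntropy X = uniformEntropy Y :=
  le_antisymm (uniformEntropy_mono fun u u' => (h u u').2)
    (uniformEntropy_mono fun u u' => (h u u').1)

lemma uniformCondEntropy_nonneg (X : U → S) (Y : U → S') : 0 ≤ uniformCondEntropy X Y :=
  sub_nonneg.2 (uniformEntropy_mono fun _ _ h => (Prod.ext_iff.1 h).2)

lemma sum_eq_sum_of_fiberCard_eq {X Y : U → S} (h : ∀ s, fiberCard X s = fiberCard Y s)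
    (φ : S → ℝ) : ∑ u, φ (X u) = ∑ u, φ (Y u) := by
  classical
  have : (Finset.univ.val.map X) = (Finset.univ.val.map Y) := by
    ext s
    have := h s
    unfold fiberCard at this
    rw [Multiset.count_map, Multiset.count_map]
    simp only [Finset.card_def, Finset.filter_val] at this
    simp only [@eq_comm _ s]
    exact this
  have h2 := congrArg (fun m => (m.map φ).sum) this
  rw [Multiset.map_map, Multiset.map_map] at h2
  exact h2

lemma uniformEntropy_eq_of_fiberCard_eq {X Y : U → S} (h : ∀ s, fiberCard X s = fiberCard Y s) :
    uniformEntropy X = uniformEntropy Y := by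
  unfold uniformEntropy
  rw [sum_eq_sum_of_fiberCard_eq h fun s => Real.log (Fintype.card U / fiberCard X s)]
  simp only [h]

lemma fiberCard_comp_equiv (e : U ≃ U') (X : U' → S) (s : S) :
    fiberCard (fun u => X (e u)) s = fiberCard X s := by
  classical
  exact Finset.card_equiv e (by simp)

lemma uniformEntropy_comp_equiv (e : U ≃ U') (X : U' → S) :
    uniformEntropy (fun u => X (e u)) = uniformEntropy X := by
  unfold uniformEntropy
  simp only [fiberCard_comp_equiv, Fintype.card_congr e]
  rw [Equiv.sum_comp e fun u => Real.log (Fintype.card U' / fiberCard X (X u))]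

/-- Counting form of ∑ p(a,c) p(b,c) / p(c) ≤ 1. Expand the numerators as counts of pairs (u₁, u₂)
and exchange sums: for a fixed pair the compatible u form one fibre of (A, B, C), or none if C u₁ ≠
C u₂. -/
lemma sum_fiberCard_mul_div_le (A : U → S) (B : U → S') (C : U → S'') :
    ∑ u, ((fiberCard (fun u => (A u, C u)) (A u, C u) * fiberCard (fun u => (B u, C u)) (B u, C u) :
        ℝ) / (fiberCard (fun u => (A u, B u, C u)) (A u, B u, C u) * fiberCard C (C u)))
      ≤ Fintype.card U := by
  classical
  have key : ∀ u₁ u₂ : U, ∑ u, (if (A u, C u) = (A u₁, C u₁) ∧ (B u, C u) = (B u₂, C u₂) then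
      ((fiberCard (fun u => (A u, B u, C u)) (A u, B u, C u) * fiberCard C (C u) : ℝ))⁻¹ else 0)
      ≤ if C u₂ = C u₁ then (fiberCard C (C u₁) : ℝ)⁻¹ else 0 := by
    intro u₁ u₂
    split_ifs with hc
    · rw [← Finset.sum_filter]
      have hf : (Finset.univ.filter fun u => (A u, C u) = (A u₁, C u₁) ∧ (B u, C u) = (B u₂, C u₂))
          = Finset.univ.filter fun u => (A u, B u, C u) = (A u₁, B u₂, C u₁) := by
        ext u
        simp only [Finset.mem_filter, Finset.mem_univ, true_and, Prod.mk.injEq, hc]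
        tauto
      rw [hf]
      set N := fiberCard (fun u => (A u, B u, C u)) (A u₁, B u₂, C u₁)
      have hN : (Finset.univ.filter fun u => (A u, B u, C u) = (A u₁, B u₂, C u₁)).card = N := by
        simp only [N, fiberCard]
        congr!
      have : ∀ u ∈ Finset.univ.filter fun u => (A u, B u, C u) = (A u₁, B u₂, C u₁),
          ((fiberCard (fun u => (A u, B u, C u)) (A u, B u, C u) * fiberCard C (C u) : ℝ))⁻¹
          = (N * fiberCard C (C u₁) : ℝ)⁻¹ := by
        intro u hu
        simp only [Finset.mem_filter, Finset.mem_univ, true_and] at hu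
        rw [hu]
        simp only [Prod.mk.injEq] at hu
        rw [hu.2.2]
      rw [Finset.sum_congr rfl this, Finset.sum_const, hN, nsmul_eq_mul, mul_inv, ← mul_assoc]
      -- The triple need not be attained, so `N` may be 0 and only N · N⁻¹ ≤ 1 is available.
      refine mul_le_of_le_one_left (by positivity) ?_
      exact mul_inv_le_one
    · refine le_of_eq (Finset.sum_eq_zero fun u _ => if_neg ?_)
      simp only [Prod.mk.injEq]
      rintro ⟨⟨_, h1⟩, _, h2⟩
      exact hc (h2.symm.trans h1)
  calc _ = ∑ u, ∑ u₁, ∑ u₂, (if (A u, C u) = (A u₁, C u₁) ∧ (B u, C u) = (B u₂, C u₂) then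
      ((fiberCard (fun u => (A u, B u, C u)) (A u, B u, C u) * fiberCard C (C u) : ℝ))⁻¹ else 0) := by
        refine Finset.sum_congr rfl fun u _ => ?_
        rw [div_eq_mul_inv]
        set c := ((fiberCard (fun u => (A u, B u, C u)) (A u, B u, C u) * fiberCard C (C u) : ℝ))⁻¹
        have h1 : (fiberCard (fun u => (A u, C u)) (A u, C u) : ℝ)
            = ∑ u₁, if (A u, C u) = (A u₁, C u₁) then 1 else 0 := by
          simp [fiberCard, eq_comm]
        have h2 : (fiberCard (fun u => (B u, C u)) (B u, C u) : ℝ)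
            = ∑ u₁, if (B u, C u) = (B u₁, C u₁) then 1 else 0 := by
          simp [fiberCard, eq_comm]
        rw [h1, h2, Finset.sum_mul_sum, Finset.sum_mul]
        refine Finset.sum_congr rfl fun u₁ _ => ?_
        rw [Finset.sum_mul]
        refine Finset.sum_congr rfl fun u₂ _ => ?_
        by_cases h3 : (A u, C u) = (A u₁, C u₁) <;> by_cases h4 : (B u, C u) = (B u₂, C u₂) <;>
          simp only [h3, h4, and_true, and_false, if_true, if_false, one_mul,
            zero_mul, mul_zero]
    _ = ∑ u₁, ∑ u₂, ∑ u, (if (A u, C u) = (A u₁, C u₁) ∧ (B u, C u) = (B u₂, C u₂) then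
      ((fiberCard (fun u => (A u, B u, C u)) (A u, B u, C u) * fiberCard C (C u) : ℝ))⁻¹ else 0) := by
        rw [Finset.sum_comm]
        exact Finset.sum_congr rfl fun u₁ _ => Finset.sum_comm
    _ ≤ ∑ u₁, ∑ u₂, if C u₂ = C u₁ then (fiberCard C (C u₁) : ℝ)⁻¹ else 0 :=
        Finset.sum_le_sum fun u₁ _ => Finset.sum_le_sum fun u₂ _ => key u₁ u₂
    _ = ∑ u₁ : U, (1 : ℝ) := by
        refine Finset.sum_congr rfl fun u₁ _ => ?_
        rw [← Finset.sum_filter, Finset.sum_const, nsmul_eq_mul]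
        exact mul_inv_cancel₀ (by exact_mod_cast (fiberCard_pos C u₁).ne')
    _ = Fintype.card U := by simp

/-- Nonnegativity of I(A; B | C): apply log x ≤ x − 1 at each point to the ratio in
`sum_fiberCard_mul_div_le`. -/
lemma uniformEntropy_submodular (A : U → S) (B : U → S') (C : U → S'') :
    uniformEntropy (fun u => (A u, B u, C u)) + uniformEntropy C
      ≤ uniformEntropy (fun u => (A u, C u)) + uniformEntropy (fun u => (B u, C u)) := by
  unfold uniformEntropy
  rw [← add_div, ← add_div]
  refine div_le_div_of_nonneg_right ?_ (Nat.cast_nonneg _)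
  rw [← Finset.sum_add_distrib, ← Finset.sum_add_distrib, ← sub_nonpos, ← Finset.sum_sub_distrib]
  have hsum := sum_fiberCard_mul_div_le A B C
  rw [← sub_nonpos, ← nsmul_one, ← Finset.card_univ, ← Finset.sum_const,
    ← Finset.sum_sub_distrib] at hsum
  refine (Finset.sum_le_sum fun u _ => ?_).trans hsum
  have hU : (0 : ℝ) < Fintype.card U := by exact_mod_cast Fintype.card_pos_iff.2 ⟨u⟩
  have h1 : (0 : ℝ) < fiberCard (fun u => (A u, C u)) (A u, C u) := by
    exact_mod_cast fiberCard_pos (fun u => (A u, C u)) u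
  have h2 : (0 : ℝ) < fiberCard (fun u => (B u, C u)) (B u, C u) := by
    exact_mod_cast fiberCard_pos (fun u => (B u, C u)) u
  have h3 : (0 : ℝ) < fiberCard (fun u => (A u, B u, C u)) (A u, B u, C u) := by
    exact_mod_cast fiberCard_pos (fun u => (A u, B u, C u)) u
  have h4 : (0 : ℝ) < fiberCard C (C u) := by exact_mod_cast fiberCard_pos C u
  refine le_trans (le_of_eq ?_) (Real.log_le_sub_one_of_pos (by positivity))
  rw [Real.log_div hU.ne' h1.ne', Real.log_div hU.ne' h2.ne', Real.log_div hU.ne' h3.ne',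
    Real.log_div hU.ne' h4.ne', Real.log_div (by positivity) (by positivity),
    Real.log_mul h1.ne' h2.ne', Real.log_mul h3.ne' h4.ne']
  ring

/-- Conditional subadditivity of entropy. -/
lemma uniformCondEntropy_pi_le {ι : Type*} [Fintype ι] (A : ι → U → S) (C : U → S') :
    uniformCondEntropy (fun u i => A i u) C ≤ ∑ i, uniformCondEntropy (A i) C := by
  classical
  -- Masking coordinates outside `J` by `none` keeps the codomain fixed during the induction.
  have key : ∀ J : Finset ι, uniformCondEntropy (fun u i => if i ∈ J then some (A i u) else none) C
      ≤ ∑ i ∈ J, uniformCondEntropy (A i) C := by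
    intro J
    induction J using Finset.induction_on with
    | empty =>
      simp only [Finset.notMem_empty, if_false, Finset.sum_empty, uniformCondEntropy]
      exact sub_nonpos.2 (uniformEntropy_mono fun u u' h => by simp [h])
    | insert a J ha ih =>
      rw [Finset.sum_insert ha]
      refine le_trans ?_ (add_le_add_right ih _)
      have := uniformEntropy_submodular (A a) (fun u i => if i ∈ J then some (A i u) else none) C
      have h2 : uniformEntropy (fun u => ((fun i => if i ∈ insert a J then some (A i u) else none),
          C u)) ≤ uniformEntropy
            (fun u => (A a u, (fun i => if i ∈ J then some (A i u) else none), C u)) := by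
        refine uniformEntropy_mono fun u u' h => ?_
        simp only [Prod.mk.injEq] at h ⊢
        refine ⟨funext fun i => ?_, h.2.2⟩
        by_cases hi : i = a
        · simp [hi, h.1]
        · simpa [hi] using congrFun h.2.1 i
      unfold uniformCondEntropy
      linarith
  have h := key Finset.univ
  simp only [Finset.mem_univ, if_true] at h
  refine le_trans (le_of_eq ?_) h
  unfold uniformCondEntropy
  rw [uniformEntropy_congr]
  intro u u'
  simp [funext_iff]

/-- The entropy of a tuple of independent coordinates. -/
lemma uniformEntropy_pi {ι : Type*} [Fintype ι] [DecidableEq ι] [Nonempty U] (Z : ι → U → S) :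
    uniformEntropy (fun (x : ι → U) i => Z i (x i)) = ∑ i, uniformEntropy (Z i) := by
  classical
  have hc : ∀ x : ι → U, fiberCard (fun (x : ι → U) i => Z i (x i)) (fun i => Z i (x i))
      = ∏ i, fiberCard (Z i) (Z i (x i)) := by
    intro x
    unfold fiberCard
    rw [← Fintype.card_piFinset]
    congr 1
    ext y
    simp [funext_iff]
  have hU : (0 : ℝ) < Fintype.card U := by exact_mod_cast Fintype.card_pos
  unfold uniformEntropy
  have hl : ∀ x : ι → U, Real.log (Fintype.card (ι → U) /
      fiberCard (fun (x : ι → U) i => Z i (x i)) (fun i => Z i (x i)))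
      = ∑ i, Real.log (Fintype.card U / fiberCard (Z i) (Z i (x i))) := by
    intro x
    rw [hc, ← Real.log_prod]
    · simp [Finset.prod_div_distrib]
    · intro i _
      have : (0 : ℝ) < fiberCard (Z i) (Z i (x i)) := by exact_mod_cast fiberCard_pos (Z i) (x i)
      positivity
  simp only [hl]
  rw [Finset.sum_comm, Finset.sum_div]
  refine Finset.sum_congr rfl fun i _ => ?_
  have := Fintype.sum_piFinset_apply
    (fun u => Real.log (Fintype.card U / fiberCard (Z i) (Z i u))) Finset.univ i
  rw [Fintype.piFinset_univ] at this
  rw [this, Finset.card_univ, nsmul_eq_mul, Fintype.card_fun, Nat.cast_pow, Nat.cast_pow,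
    div_eq_div_iff (by positivity) (by positivity)]
  have hp : Fintype.card ι = Fintype.card ι - 1 + 1 := by
    have : 0 < Fintype.card ι := Fintype.card_pos_iff.2 ⟨i⟩
    omega
  conv_rhs => rw [hp, pow_succ]
  ring

/-- The fibres are cosets of the kernel, hence all of the same size. -/
lemma uniformEntropy_of_surjective [AddGroup U] [AddGroup S] [Fintype S] (X : U →+ S)
    (hX : Function.Surjective X) : uniformEntropy X = Real.log (Fintype.card S) := by
  classical
  have hc : ∀ u, Fintype.card U = Fintype.card S * fiberCard X (X u) := by
    intro u
    have := Finset.card_eq_sum_card_fiberwise (f := X) (s := Finset.univ) (t := Finset.univ)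
      (fun _ _ => Finset.mem_coe.2 (Finset.mem_univ _))
    rw [Finset.card_univ] at this
    rw [this, Finset.sum_congr rfl fun b _ => AddMonoidHom.card_fiber_eq_of_mem_range X
      (hX b) (hX (X u)), Finset.sum_const, Finset.card_univ, smul_eq_mul, fiberCard]
  have hl : ∀ u, Real.log (Fintype.card U / fiberCard X (X u)) = Real.log (Fintype.card S) := by
    intro u
    have : (fiberCard X (X u) : ℝ) ≠ 0 := by exact_mod_cast (fiberCard_pos X u).ne'
    rw [hc u, Nat.cast_mul, mul_div_cancel_right₀ _ this]
  have hU : (Fintype.card U : ℝ) ≠ 0 := by exact_mod_cast Fintype.card_ne_zero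
  unfold uniformEntropy
  rw [Finset.sum_congr rfl fun u _ => hl u, Finset.sum_const, Finset.card_univ, nsmul_eq_mul,
    mul_div_cancel_left₀ _ hU]

end UniformEntropy

end PLC

namespace PLC

/-! ### Information sets and linear function evaluations -/

section Linear

variable {F : Type w} [Field F] {n k f μ β : ℕ} {J S : Type*}

/-- Encoding commutes with combining messages, so each database determines its own coded symbols of
every evaluation. -/
lemma sum_evaluation_mul (G : Matrix (Fin k) (Fin n) F) (V : Matrix (Fin μ) (Fin f) F)
    (W : Fin f → Fin β → Fin k → F) (v : Fin μ) (b : Fin β) (j : Fin n) :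
    ∑ l, evaluation V W v b l * G l j = ∑ m, V v m * stored G W j m b := by
  simp only [evaluation, stored, Finset.sum_mul, Finset.mul_sum]
  rw [Finset.sum_comm]
  simp only [mul_assoc]

lemma vecMul_submatrix_apply (G : Matrix (Fin k) (Fin n) F) {I : Finset (Fin n)}
    (e : Fin k ≃ I) (x : Fin k → F) (i : Fin k) :
    Matrix.vecMul x (G.submatrix id fun i => (e i : Fin n)) i = ∑ l, x l * G l (e i) := by
  simp [Matrix.vecMul, dotProduct]

lemma evaluation_eq_iff_of_isUnit {G : Matrix (Fin k) (Fin n) F} {I : Finset (Fin n)}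
    {e : Fin k ≃ I} (he : IsUnit (G.submatrix id fun i => (e i : Fin n)))
    (V : Matrix (Fin μ) (Fin f) F) (v : Fin μ) (W W' : Fin f → Fin β → Fin k → F) :
    evaluation V W v = evaluation V W' v ↔
      ∀ i b, ∑ m, V v m * stored G W (e i) m b = ∑ m, V v m * stored G W' (e i) m b := by
  constructor
  · intro h i b
    rw [← sum_evaluation_mul, ← sum_evaluation_mul, h]
  · intro h
    funext b
    refine Matrix.vecMul_injective_of_isUnit he (funext fun i => ?_)
    simp only [vecMul_submatrix_apply, sum_evaluation_mul, h]

/-- The symbols stored on an information set are in bijection with the messages. -/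
lemma stored_bijective [Fintype F] {G : Matrix (Fin k) (Fin n) F} {I : Finset (Fin n)}
    {e : Fin k ≃ I} (he : IsUnit (G.submatrix id fun i => (e i : Fin n))) :
    Function.Bijective fun (W : Fin f → Fin β → Fin k → F) (i : Fin k) => stored G W (e i) := by
  classical
  rw [Fintype.bijective_iff_injective_and_card]
  constructor
  · intro W W' h
    funext m b
    refine Matrix.vecMul_injective_of_isUnit he (funext fun i => ?_)
    simp only [vecMul_submatrix_apply]
    exact congrFun (congrFun (congrFun h i) m) b
  · simp only [Fintype.card_fun, Fintype.card_fin, ← pow_mul]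
    congr 1
    ring

/-- Given evaluations of candidate functions, functions of the contents of the databases of an
information set are independent. -/
lemma IsInformationSet.sum_uniformCondEntropy_le [Fintype F] {G : Matrix (Fin k) (Fin n) F}
    {I : Finset (Fin n)} (hI : IsInformationSet G I) (V : Matrix (Fin μ) (Fin f) F)
    (σ : J → Fin μ) (a : Fin n → (Fin f → Fin β → F) → S) :
    ∑ j ∈ I, uniformCondEntropy (fun W : Fin f → Fin β → Fin k → F => a j (stored G W j))
        (fun W i => evaluation V W (σ i)) ≤
      uniformCondEntropy (fun W : Fin f → Fin β → Fin k → F => fun j => a j (stored G W j))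
        (fun W i => evaluation V W (σ i)) := by
  classical
  obtain ⟨e, he⟩ := hI
  -- `y` is one database's share of the evaluations; the shares on `I` together are equivalent to
  -- the evaluations. In `Z`, the mask `K` equal to ∅, {i} or everything yields the three entropies
  -- to compare.
  let y : (Fin f → Fin β → F) → J → Fin β → F := fun c i b => ∑ m, V (σ i) m * c m b
  let Z : Finset (Fin k) → Fin k → (Fin f → Fin β → F) → Option S × (J → Fin β → F) :=
    fun K i c => (if i ∈ K then some (a (e i) c) else none, y c)
  let A : Fin k → ℝ := fun i => uniformEntropy fun c => (a (e i) c, y c)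
  have hX : ∀ W W' : Fin f → Fin β → Fin k → F,
      ((fun i => evaluation V W (σ i)) = fun i => evaluation V W' (σ i)) ↔
        ∀ i, y (stored G W (e i)) = y (stored G W' (e i)) := by
    intro W W'
    simp only [funext_iff (β := fun _ : J => Fin β → Fin k → F), evaluation_eq_iff_of_isUnit he]
    simp only [y, funext_iff]
    exact ⟨fun h i j b => h j i b, fun h j i b => h i j b⟩
  have hZ : ∀ K, uniformEntropy (fun (W : Fin f → Fin β → Fin k → F) i => Z K i (stored G W (e i)))
      = ∑ i, if i ∈ K then A i else uniformEntropy y := by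
    intro K
    have h1 := uniformEntropy_comp_equiv
      (Equiv.ofBijective _ (stored_bijective (f := f) (β := β) he))
      (fun (c : Fin k → Fin f → Fin β → F) i => Z K i (c i))
    refine h1.trans ?_
    rw [uniformEntropy_pi]
    refine Finset.sum_congr rfl fun i _ => ?_
    split_ifs with hi
    · exact uniformEntropy_congr fun u u' => by simp [Z, hi]
    · exact uniformEntropy_congr fun u u' => by simp [Z, hi]
  have hbase : uniformEntropy (fun (W : Fin f → Fin β → Fin k → F) i => evaluation V W (σ i))
      = ∑ i : Fin k, uniformEntropy y := by
    rw [show ∑ i : Fin k, uniformEntropy y = _ from (hZ ∅).trans (by simp) |>.symm]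
    exact uniformEntropy_congr fun W W' => by simp [hX, Z, funext_iff (α := Fin k)]
  have hsingle : ∀ i, uniformEntropy (fun W : Fin f → Fin β → Fin k → F =>
      (a (e i) (stored G W (e i)), fun i => evaluation V W (σ i)))
      = (∑ i : Fin k, uniformEntropy y) + (A i - uniformEntropy y) := by
    intro i
    have h2 : ∑ i' : Fin k, (if i' ∈ ({i} : Finset (Fin k)) then A i' else uniformEntropy y)
        = (∑ i : Fin k, uniformEntropy y) + (A i - uniformEntropy y) := by
      rw [← sub_eq_iff_eq_add', ← Finset.sum_sub_distrib, Finset.sum_eq_single i]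
      · simp
      · intro i' _ hi'
        simp [hi']
      · simp
    rw [← h2, ← hZ]
    refine uniformEntropy_congr fun W W' => ?_
    simp only [Prod.mk.injEq, hX, Z, funext_iff (α := Fin k), Finset.mem_singleton, forall_and]
    refine and_congr_left fun _ => ⟨fun h i' => ?_, fun h => by simpa using h i⟩
    by_cases hi : i' = i
    · subst hi; simp [h]
    · simp [hi]
  -- Only an inequality, because the right side also records the databases outside `I`.
  have hall : ∑ i, A i ≤ uniformEntropy (fun W : Fin f → Fin β → Fin k → F =>
      ((fun j => a j (stored G W j)), fun i => evaluation V W (σ i))) := by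
    rw [show ∑ i, A i = _ from (hZ Finset.univ).trans (by simp) |>.symm]
    refine uniformEntropy_mono fun W W' h => ?_
    simp only [Prod.mk.injEq, hX] at h
    simp only [Z, funext_iff (α := Fin k), Finset.mem_univ, if_true, Prod.mk.injEq, h.2,
      Option.some.injEq, and_true]
    exact fun i => congrFun h.1 _
  rw [← Finset.sum_coe_sort, ← Equiv.sum_comp e]
  simp only [uniformCondEntropy, hsingle, hbase, add_sub_cancel_left, Finset.sum_sub_distrib]
  linarith

/-- Pick an information set in each row. Column j lies in at most κ of them, and their sizes total
νk = κn, so it lies in exactly κ. Summing the hypothesis over the rows gives κ ∑ φ ≤ ν c. -/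
lemma IsMDSPIRCapacityAchieving.div_mul_sum_le [Fintype F] {G : Matrix (Fin k) (Fin n) F}
    (hG : IsMDSPIRCapacityAchieving G) (hk : 0 < k) {φ : Fin n → ℝ} {c : ℝ}
    (h : ∀ I, IsInformationSet G I → ∑ j ∈ I, φ j ≤ c) : (k : ℝ) / n * ∑ j, φ j ≤ c := by
  classical
  obtain ⟨κ, ν, Λ, hν, ⟨hcol, hrow⟩, hr⟩ := hG
  choose I hI hIΛ using hrow
  have hcard : ∀ i, (I i).card = k := fun i => by
    obtain ⟨e, _⟩ := hI i
    simpa using (Fintype.card_congr e).symm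
  have hn : 0 < n := by
    have := Finset.card_le_univ (I ⟨0, hν⟩)
    rw [hcard, Fintype.card_fin] at this
    omega
  have hκ : κ * n = k * ν := by
    rw [div_eq_div_iff (by positivity) (by positivity)] at hr
    exact_mod_cast hr
  have hle : ∀ j ∈ Finset.univ, (Finset.univ.filter fun i => j ∈ I i).card ≤ κ := fun j _ => by
    rw [← hcol j]
    refine Finset.card_le_card fun i hi => ?_
    simp only [Finset.mem_filter, Finset.mem_univ, true_and] at hi ⊢
    exact hIΛ i j hi
  have hsum : ∑ j, (Finset.univ.filter fun i => j ∈ I i).card = ∑ _j : Fin n, κ := by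
    have : ∀ j, (Finset.univ.filter fun i => j ∈ I i).card = ∑ i, if j ∈ I i then 1 else 0 :=
      fun j => by simp
    simp only [this]
    rw [Finset.sum_comm]
    simp [hcard, mul_comm n κ, hκ, mul_comm k ν]
  have heq := (Finset.sum_eq_sum_iff_of_le hle).1 hsum
  have h1 : ∑ i, ∑ j ∈ I i, φ j = κ * ∑ j, φ j := by
    have : ∀ i, ∑ j ∈ I i, φ j = ∑ j, if j ∈ I i then φ j else 0 := fun i => by simp
    simp only [this]
    rw [Finset.sum_comm, Finset.mul_sum]
    refine Finset.sum_congr rfl fun j hj => ?_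
    rw [← Finset.sum_filter, Finset.sum_const, heq j hj, nsmul_eq_mul]
  have h2 : ∑ i, ∑ j ∈ I i, φ j ≤ ν * c := by
    simpa using Finset.sum_le_sum fun i (_ : i ∈ Finset.univ) => h (I i) (hI i)
  have hνR : (0 : ℝ) < ν := by exact_mod_cast hν
  have hnR : (0 : ℝ) < n := by exact_mod_cast hn
  have hkn : (k : ℝ) / n = κ / ν := by
    rw [div_eq_div_iff hnR.ne' hνR.ne']
    exact_mod_cast hκ.symm
  rw [hkn, div_mul_eq_mul_div, div_le_iff₀ hνR, ← h1, mul_comm c]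
  exact h2

/-- Independent rows make the evaluation map surjective: a preimage is found by solving one linear
system per position (b, l). -/
lemma uniformEntropy_evaluation [Fintype F] [Fintype J] (V : Matrix (Fin μ) (Fin f) F)
    {σ : J → Fin μ} (hσ : LinearIndependent F fun i => V (σ i)) :
    uniformEntropy (fun (W : Fin f → Fin β → Fin k → F) i => evaluation V W (σ i)) =
      Fintype.card J * ((β * k : ℕ) * Real.log (Fintype.card F)) := by
  classical
  let X : (Fin f → Fin β → Fin k → F) →+ (J → Fin β → Fin k → F) :=
    { toFun := fun W i => evaluation V W (σ i)
      map_zero' := by ext; simp [evaluation]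
      map_add' := fun W W' => by ext; simp [evaluation, mul_add, Finset.sum_add_distrib] }
  have hX : Function.Surjective X := by
    let M : Matrix J (Fin f) F := Matrix.of fun i => V (σ i)
    have hM : LinearMap.range M.mulVecLin = ⊤ := by
      apply Submodule.eq_top_of_finrank_eq
      have : M.rank = Fintype.card J := LinearIndependent.rank_matrix hσ
      rw [Module.finrank_fintype_fun_eq_card, ← this]
      rfl
    intro x
    have h1 : ∀ b l, ∃ c, M.mulVec c = fun i => x i b l := fun b l =>
      LinearMap.range_eq_top.1 hM _
    choose c hc using h1
    exact ⟨fun m b l => c b l m, by ext i b l; exact congrFun (hc b l) i⟩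
  have := uniformEntropy_of_surjective X hX
  refine this.trans ?_
  simp only [Fintype.card_fun, Fintype.card_fin, Nat.cast_pow, Real.log_pow, Nat.cast_mul]
  ring

lemma exists_linearIndependent_rows (V : Matrix (Fin μ) (Fin f) F) (v₀ : Fin μ) :
    ∃ σ : ℕ → Fin μ, ∀ t ≤ V.rank, LinearIndependent F fun i : Fin t => V (σ i) := by
  obtain ⟨g, hg, -, hli⟩ := Submodule.exists_fun_fin_finrank_span_eq F (Set.range V.row)
  choose s hs using hg
  rw [Matrix.rank_eq_finrank_span_row]
  -- `v₀` is a filler: prefixes of length at most the rank never reach it.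
  refine ⟨fun i => if h : i < _ then s ⟨i, h⟩ else v₀, fun t ht => ?_⟩
  have : (fun i : Fin t => V (if h : (i : ℕ) < _ then s ⟨i, h⟩ else v₀)) =
      fun i => g (Fin.castLE ht i) := by
    funext i
    rw [dif_pos (i.2.trans_le ht)]
    exact hs _
  rw [this]
  exact hli.comp _ (Fin.castLE_injective ht)

end Linear

end PLC

namespace PLC

/-! ### Discrete random variables -/

section Probability

variable {Ω S T U : Type*}

lemma tsum_map_mul (P : PMF Ω) (X : Ω → S) (φ : S → ℝ≥0∞) :
    ∑' s, (P.map X) s * φ s = ∑' ω, P ω * φ (X ω) := by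
  classical
  simp only [PMF.map_apply, ← ENNReal.tsum_mul_right]
  rw [ENNReal.tsum_comm]
  refine tsum_congr fun ω => ?_
  rw [tsum_eq_single (X ω)]
  · simp
  · intro s hs
    simp [hs]

/-- Were X different at two support points with equal Y, the mass of the second would force p(x,y) <
p(y), and the summand at (x, y) would be positive. -/
lemma eq_of_condEntropy_eq_zero {q : ℕ} (hq : 1 < q) {P : PMF Ω} {X : Ω → S} {Y : Ω → T}
    (h : condEntropy q P X Y = 0) {ω ω' : Ω} (hω : ω ∈ P.support) (hω' : ω' ∈ P.support)
    (hY : Y ω = Y ω') : X ω = X ω' := by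
  classical
  by_contra hX
  have h1 := ENNReal.tsum_eq_zero.1 h (X ω, Y ω)
  set p := (P.map fun ω => (X ω, Y ω)) (X ω, Y ω) with hp
  set r := (P.map Y) (Y ω) with hr
  have hp0 : p ≠ 0 := (PMF.mem_support_map_iff _ _ _).2 ⟨ω, hω, rfl⟩
  have hlt : p < r := by
    have hle : p + P ω' ≤ r := by
      rw [hp, hr, PMF.map_apply, PMF.map_apply, ← tsum_ite_eq ω' (fun _ => P ω'),
        ← ENNReal.tsum_add]
      refine ENNReal.tsum_le_tsum fun a => ?_
      by_cases ha : a = ω'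
      · subst ha
        simp [hX, hY]
      · by_cases hXa : X ω = X a <;> by_cases hYa : Y ω = Y a <;> simp [ha, hXa, hYa]
    exact lt_of_lt_of_le (ENNReal.lt_add_right (PMF.apply_ne_top _ _) hω') hle
  have hpR : 0 < p.toReal := ENNReal.toReal_pos hp0 (PMF.apply_ne_top _ _)
  have hltR : p.toReal < r.toReal := (ENNReal.toReal_lt_toReal (PMF.apply_ne_top _ _)
    (PMF.apply_ne_top _ _)).2 hlt
  have hlog : 0 < Real.log (r.toReal / p.toReal) := Real.log_pos ((one_lt_div hpR).2 hltR)
  have hlq : 0 < Real.log q := Real.log_pos (by exact_mod_cast hq)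
  rw [ENNReal.ofReal_eq_zero] at h1
  exact absurd h1 (not_le.2 (by positivity))

lemma exists_eq_comp_on {s : Set Ω} (hs : s.Nonempty) {X : Ω → S} {Y : Ω → T}
    (h : ∀ ω ∈ s, ∀ ω' ∈ s, Y ω = Y ω' → X ω = X ω') : ∃ g : T → S, ∀ ω ∈ s, X ω = g (Y ω) := by
  classical
  obtain ⟨ω₀, _⟩ := hs
  refine ⟨fun y => if hy : ∃ ω ∈ s, Y ω = y then X hy.choose else X ω₀, fun ω hω => ?_⟩
  have hy : ∃ ω' ∈ s, Y ω' = Y ω := ⟨ω, hω, rfl⟩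
  simp only [dif_pos hy]
  exact h _ hω _ hy.choose_spec.1 hy.choose_spec.2.symm

lemma Indep.comp_left {P : PMF Ω} {X : Ω → S} {Y : Ω → T} (h : Indep P X Y) (g : S → U) :
    Indep P (fun ω => g (X ω)) Y := by
  classical
  intro z y
  have h1 : (P.map fun ω => (g (X ω), Y ω)) (z, y) =
      ∑' ω, P ω * (fun p : S × T => if g p.1 = z ∧ p.2 = y then 1 else 0) (X ω, Y ω) := by
    rw [PMF.map_apply]
    refine tsum_congr fun ω => ?_
    simp [eq_comm]
  have h2 : (P.map fun ω => g (X ω)) z = ∑' x, if g x = z then (P.map X) x else 0 := by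
    rw [← Function.comp_def g X, ← PMF.map_comp, PMF.map_apply]
    simp only [eq_comm]
  rw [h1, ← tsum_map_mul P (fun ω => (X ω, Y ω))
    fun p : S × T => if g p.1 = z ∧ p.2 = y then 1 else 0, ENNReal.tsum_prod', h2,
    ← ENNReal.tsum_mul_right]
  refine tsum_congr fun x => ?_
  rw [tsum_eq_single y]
  · rw [h]
    by_cases hx : g x = z <;> simp [hx]
  · intro y' hy'
    simp [hy']

/-! ### Queries independent of a uniform message. -/

variable [Fintype U] [Nonempty U]

/-- A product law with a uniform factor lets every message occur with every possible query; this
turns almost sure statements into statements about all messages. -/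
lemma Indep.exists_mem_support {P : PMF Ω} {Q : Ω → S} {W : Ω → U}
    (hW : P.map W = PMF.uniformOfFintype U) (h : Indep P Q W) {ω : Ω} (hω : ω ∈ P.support)
    (w : U) : ∃ ω' ∈ P.support, Q ω' = Q ω ∧ W ω' = w := by
  have h1 : (Q ω, w) ∈ (P.map fun ω => (Q ω, W ω)).support := by
    rw [PMF.mem_support_iff, h, hW]
    refine mul_ne_zero ((PMF.mem_support_map_iff _ _ _).2 ⟨ω, hω, rfl⟩) ?_
    exact (PMF.mem_support_iff _ _).1 (PMF.mem_support_uniformOfFintype w)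
  obtain ⟨ω', hω', h'⟩ := (PMF.mem_support_map_iff _ _ _).1 h1
  exact ⟨ω', hω', Prod.ext_iff.1 h'⟩

/-- The joint law of `Q` and a function of `Q` and an independent uniform random element. -/
lemma Indep.map_apply_eq {P : PMF Ω} {Q : Ω → S} {W : Ω → U} {A : Ω → T}
    (hW : P.map W = PMF.uniformOfFintype U) (h : Indep P Q W) {g : S → U → T}
    (hg : ∀ ω ∈ P.support, A ω = g (Q ω) (W ω)) (z : S) (a : T) :
    (P.map fun ω => (Q ω, A ω)) (z, a) =
      (P.map Q) z * ((fiberCard (g z) a : ℝ≥0∞) / Fintype.card U) := by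
  classical
  have h1 : (P.map fun ω => (Q ω, A ω)) (z, a) =
      ∑' ω, P ω * (fun p : S × U => if p.1 = z ∧ g p.1 p.2 = a then 1 else 0) (Q ω, W ω) := by
    rw [PMF.map_apply]
    refine tsum_congr fun ω => ?_
    by_cases hω : P ω = 0
    · simp [hω]
    · have := hg ω hω
      simp [this, eq_comm]
  rw [h1, ← tsum_map_mul P (fun ω => (Q ω, W ω))
    fun p : S × U => if p.1 = z ∧ g p.1 p.2 = a then 1 else 0, ENNReal.tsum_prod', tsum_eq_single z]
  · simp only [h z, hW, PMF.uniformOfFintype_apply, mul_assoc]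
    rw [ENNReal.tsum_mul_left, ENNReal.tsum_mul_left, tsum_fintype, mul_comm _⁻¹, div_eq_mul_inv]
    congr 2
    simp [fiberCard]
  · intro z' hz'
    simp [hz']

/-- Privacy in counting form: given a query of positive mass, the law of the answer is fibre size
over |U|, so equal joint laws cancel to equal fibre sizes. -/
lemma fiberCard_eq_of_map_eq {P : PMF Ω} {Q Q' : Ω → S} {W : Ω → U} {A A' : Ω → T}
    (hW : P.map W = PMF.uniformOfFintype U) (h : Indep P Q W) (h' : Indep P Q' W)
    {g g' : S → U → T} (hg : ∀ ω ∈ P.support, A ω = g (Q ω) (W ω))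
    (hg' : ∀ ω ∈ P.support, A' ω = g' (Q' ω) (W ω))
    (hmap : (P.map fun ω => (Q ω, A ω)) = P.map fun ω => (Q' ω, A' ω))
    (hQ : P.map Q = P.map Q') {z : S} (hz : (P.map Q) z ≠ 0) (a : T) :
    fiberCard (g z) a = fiberCard (g' z) a := by
  have h1 := h.map_apply_eq hW hg z a
  rw [hmap, h'.map_apply_eq hW hg' z a, hQ] at h1
  rw [hQ] at hz
  have h2 := (ENNReal.mul_right_inj hz (PMF.apply_ne_top _ _)).1 h1
  rw [div_eq_mul_inv, div_eq_mul_inv, ENNReal.mul_left_inj (by simp) (by simp)] at h2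
  exact_mod_cast h2.symm

/-- Jensen's inequality for `Real.negMulLog`. -/
lemma tsum_mul_negMulLog_le {p : S → ℝ} (hp0 : ∀ s, 0 ≤ p s) (hp : HasSum p 1) {x : S → ℝ}
    (hx : ∀ s, x s ∈ Set.Icc (0 : ℝ) 1) {m : ℝ} (hm : HasSum (fun s => p s * x s) m) :
    Summable (fun s => p s * Real.negMulLog (x s)) ∧
      ∑' s, p s * Real.negMulLog (x s) ≤ Real.negMulLog m := by
  have hn : ∀ s, 0 ≤ p s * Real.negMulLog (x s) := fun s =>
    mul_nonneg (hp0 s) (Real.negMulLog_nonneg (hx s).1 (hx s).2)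
  have hpx : ∀ s, 0 ≤ p s * x s := fun s => mul_nonneg (hp0 s) (hx s).1
  have hm0 : 0 ≤ m := hm.nonneg hpx
  rcases hm0.eq_or_lt with h0 | h0
  · have hz : ∀ s, p s * Real.negMulLog (x s) = 0 := fun s => by
      have h1 := (hasSum_zero_iff_of_nonneg hpx).1 (h0 ▸ hm)
      rcases mul_eq_zero.1 (congrFun h1 s) with h2 | h2 <;> simp [h2]
    simp [hz, ← h0, summable_zero]
  -- The tangent line of `Real.negMulLog` at `m`, weighted by `p s`; it also serves as the summable
  -- majorant.
  · have hle : ∀ s, p s * Real.negMulLog (x s) ≤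
        -(p s * x s) * Real.log m + (p s * m - p s * x s) := by
      intro s
      have hs : Real.negMulLog (x s) ≤ -x s * Real.log m + (m - x s) := by
        rcases (hx s).1.eq_or_lt with h1 | h1
        · simp [← h1, hm0]
        · have h2 := Real.log_le_sub_one_of_pos (div_pos h0 h1)
          rw [Real.log_div h0.ne' h1.ne'] at h2
          have h3 := mul_le_mul_of_nonneg_left h2 h1.le
          rw [mul_sub, mul_sub, mul_div_cancel₀ _ h1.ne'] at h3
          unfold Real.negMulLog
          linarith
      calc p s * Real.negMulLog (x s) ≤ p s * (-x s * Real.log m + (m - x s)) :=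
            mul_le_mul_of_nonneg_left hs (hp0 s)
        _ = _ := by ring
    have hsum : HasSum (fun s => -(p s * x s) * Real.log m + (p s * m - p s * x s))
        (-m * Real.log m + (1 * m - m)) :=
      (hm.neg.mul_right _).add ((hp.mul_right m).sub hm)
    have hs : Summable fun s => p s * Real.negMulLog (x s) :=
      Summable.of_nonneg_of_le hn hle hsum.summable
    refine ⟨hs, (hasSum_le hle hs.hasSum hsum).trans (le_of_eq ?_)⟩
    unfold Real.negMulLog
    ring

/-- Grouping points by fibre passes from an average over points to the Shannon sum over values. -/
lemma tsum_negMulLog_fiberCard (X : U → S) {c : ℝ} (hc : 0 ≤ c) :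
    ∑' s, ENNReal.ofReal (Real.negMulLog (fiberCard X s / Fintype.card U) / c) =
      ENNReal.ofReal (uniformEntropy X / c) := by
  classical
  have hU : (0 : ℝ) < Fintype.card U := by exact_mod_cast Fintype.card_pos
  have hzero : ∀ s ∉ Finset.univ.image X, fiberCard X s = 0 := by
    intro s hs
    refine Finset.card_eq_zero.2 (Finset.filter_eq_empty_iff.2 fun u _ hu => hs ?_)
    exact Finset.mem_image.2 ⟨u, Finset.mem_univ _, hu⟩
  rw [tsum_eq_sum (s := Finset.univ.image X) fun s hs => by simp [hzero s hs],
    ← ENNReal.ofReal_sum_of_nonneg]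
  · congr 1
    rw [← Finset.sum_div]
    congr 1
    unfold uniformEntropy
    rw [← Finset.sum_fiberwise_of_maps_to (t := Finset.univ.image X) (g := X)
      (fun u _ => Finset.mem_image_of_mem X (Finset.mem_univ u)), Finset.sum_div]
    refine Finset.sum_congr rfl fun s _ => ?_
    rw [Finset.sum_congr rfl (g := fun _ => Real.log (Fintype.card U / fiberCard X s))
      fun u hu => by rw [(Finset.mem_filter.1 hu).2], Finset.sum_const, nsmul_eq_mul,
      Real.negMulLog, ← inv_div, Real.log_inv, fiberCard]
    simp only [neg_mul, mul_neg, neg_neg]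
    rw [inv_div, mul_div_right_comm]
  · intro s _
    refine div_nonneg (Real.negMulLog_nonneg (by positivity) ?_) hc
    rw [div_le_one hU]
    exact_mod_cast fiberCard_le X s

/-- Conditioning reduces entropy. -/
lemma Indep.tsum_uniformEntropy_le_entropy {q : ℕ} {P : PMF Ω} {Q : Ω → S} {W : Ω → U}
    {A : Ω → T} (hW : P.map W = PMF.uniformOfFintype U) (h : Indep P Q W) {g : S → U → T}
    (hg : ∀ ω ∈ P.support, A ω = g (Q ω) (W ω)) :
    ∑' ω, P ω * ENNReal.ofReal (uniformEntropy (g (Q ω)) / Real.log q) ≤ entropy q P A := by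
  classical
  have hlq : 0 ≤ Real.log q := Real.log_natCast_nonneg q
  have hU : (0 : ℝ) < Fintype.card U := by exact_mod_cast Fintype.card_pos
  rw [← tsum_map_mul P Q fun z => ENNReal.ofReal (uniformEntropy (g z) / Real.log q)]
  simp only [← tsum_negMulLog_fiberCard _ hlq, ← ENNReal.tsum_mul_left]
  rw [ENNReal.tsum_comm]
  refine ENNReal.tsum_le_tsum fun a => ?_
  have hx : ∀ z, (fiberCard (g z) a / Fintype.card U : ℝ) ∈ Set.Icc (0 : ℝ) 1 := fun z =>
    ⟨by positivity, by rw [div_le_one hU]; exact_mod_cast fiberCard_le _ _⟩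
  have hp : HasSum (fun z => ((P.map Q) z).toReal) 1 := by
    have := ENNReal.hasSum_toReal (PMF.tsum_coe_ne_top (P.map Q))
    rwa [← ENNReal.tsum_toReal_eq fun _ => PMF.apply_ne_top _ _, PMF.tsum_coe,
      ENNReal.toReal_one] at this
  -- The law of `A` is a mixture over queries; Jensen is applied separately at each value `a`.
  have hA : (P.map A) a = ∑' z, (P.map Q) z * ((fiberCard (g z) a : ℝ≥0∞) / Fintype.card U) := by
    rw [tsum_congr fun z => (h.map_apply_eq hW hg z a).symm]
    simp only [PMF.map_apply]
    rw [ENNReal.tsum_comm]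
    refine tsum_congr fun ω => ?_
    rw [tsum_eq_single (Q ω)]
    · simp
    · intro z hz
      simp [hz]
  have hm : HasSum (fun z => ((P.map Q) z).toReal * (fiberCard (g z) a / Fintype.card U))
      ((P.map A) a).toReal := by
    have hne : ∑' z, (P.map Q) z * ((fiberCard (g z) a : ℝ≥0∞) / Fintype.card U) ≠ ⊤ :=
      hA ▸ PMF.apply_ne_top _ _
    have := ENNReal.hasSum_toReal hne
    rw [← ENNReal.tsum_toReal_eq (ENNReal.ne_top_of_tsum_ne_top hne), ← hA] at this
    simpa [ENNReal.toReal_mul, ENNReal.toReal_div] using this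
  obtain ⟨hs, hle⟩ := tsum_mul_negMulLog_le (fun _ => ENNReal.toReal_nonneg) hp hx hm
  have hn : ∀ z, 0 ≤ ((P.map Q) z).toReal * Real.negMulLog (fiberCard (g z) a / Fintype.card U) :=
    fun z => mul_nonneg ENNReal.toReal_nonneg (Real.negMulLog_nonneg (hx z).1 (hx z).2)
  refine le_trans (le_of_eq ?_)
    (ENNReal.ofReal_le_ofReal (div_le_div_of_nonneg_right hle hlq))
  rw [← tsum_div_const, ENNReal.ofReal_tsum_of_nonneg (fun z => div_nonneg (hn z) hlq)
    (hs.div_const _)]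
  refine tsum_congr fun z => ?_
  rw [mul_div_assoc, ENNReal.ofReal_mul ENNReal.toReal_nonneg,
    ENNReal.ofReal_toReal (PMF.apply_ne_top _ _)]

/-- The entropy of a symbol of the alphabet `F` is at most one `|F|`-ary unit. -/
lemma entropy_le_one {F : Type*} [Fintype F] [Nontrivial F] (P : PMF Ω) (X : Ω → F) :
    entropy (Fintype.card F) P X ≤ 1 := by
  have hF : (0 : ℝ) < Fintype.card F := by exact_mod_cast Fintype.card_pos
  have hlog : 0 < Real.log (Fintype.card F) :=
    Real.log_pos (by exact_mod_cast Fintype.one_lt_card)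
  have hle : ∀ x, ((P.map X) x).toReal ≤ 1 := fun x =>
    ENNReal.toReal_le_of_le_ofReal zero_le_one (ENNReal.ofReal_one ▸ PMF.coe_le_one _ x)
  have hsum : ∑ x, ((P.map X) x).toReal = 1 := by
    rw [← ENNReal.toReal_sum fun _ _ => PMF.apply_ne_top _ _, ← tsum_fintype (L := .unconditional _), PMF.tsum_coe,
      ENNReal.toReal_one]
  have hn : ∀ x, 0 ≤ Real.negMulLog ((P.map X) x).toReal := fun x =>
    Real.negMulLog_nonneg ENNReal.toReal_nonneg (hle x)
  unfold entropy
  rw [tsum_fintype, ← ENNReal.ofReal_sum_of_nonneg fun x _ => div_nonneg (hn x) hlog.le,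
    ← Finset.sum_div, ← ENNReal.ofReal_one]
  refine ENNReal.ofReal_le_ofReal ((div_le_one hlog).2 ?_)
  -- Jensen with uniform weights: the probabilities average to 1/|F|.
  have hj := (tsum_mul_negMulLog_le (S := F) (p := fun _ => (Fintype.card F : ℝ)⁻¹)
    (x := fun x => ((P.map X) x).toReal) (m := (Fintype.card F : ℝ)⁻¹)
    (fun _ => by positivity)
    (by
      have := hasSum_fintype fun _ : F => (Fintype.card F : ℝ)⁻¹
      simpa [hF.ne'] using this)
    (fun x => ⟨ENNReal.toReal_nonneg, hle x⟩)
    (by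
      have := hasSum_fintype fun x : F => (Fintype.card F : ℝ)⁻¹ * ((P.map X) x).toReal
      rwa [← Finset.mul_sum, hsum, mul_one] at this)).2
  rw [tsum_fintype, ← Finset.mul_sum, Real.negMulLog, Real.log_inv, neg_mul_neg] at hj
  exact le_of_mul_le_mul_left hj (by positivity)

end Probability

end PLC

namespace PLC

/-! ### The converse bound for protocols -/

section Converse

variable {F : Type w} [Field F] [Fintype F] {n k f μ : ℕ} {G : Matrix (Fin k) (Fin n) F}
  {V : Matrix (Fin μ) (Fin f) F}

lemma Protocol.exists_answer (S : Protocol.{u} G V) (v : Fin μ) (j : Fin n) :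
    ∃ g : S.QAlph → (Fin f → Fin S.β → F) → S.AAlph,
      ∀ ω ∈ S.P.support, S.A v j ω = g (S.Q v j ω) (stored G (S.W ω) j) := by
  obtain ⟨g, hg⟩ := exists_eq_comp_on S.P.support_nonempty (X := S.A v j)
    (Y := fun ω => (S.Q v j ω, stored G (S.W ω) j)) fun ω hω ω' hω' h =>
      eq_of_condEntropy_eq_zero Fintype.one_lt_card (S.answer v j) hω hω' h
  exact ⟨fun q c => g (q, c), hg⟩

/-- The answer of database `j` as a function of its query and its content. -/
noncomputable def Protocol.answerFun (S : Protocol.{u} G V) (v : Fin μ) (j : Fin n) :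
    S.QAlph → (Fin f → Fin S.β → F) → S.AAlph :=
  (S.exists_answer v j).choose

lemma Protocol.answer_eq (S : Protocol.{u} G V) (v : Fin μ) (j : Fin n) {ω : S.Ω}
    (hω : ω ∈ S.P.support) : S.A v j ω = S.answerFun v j (S.Q v j ω) (stored G (S.W ω) j) :=
  (S.exists_answer v j).choose_spec ω hω

/-- The entropy of the answer of database `j` to the query `q`, given the evaluations of the first
`t` functions selected by `σ`. -/
noncomputable def Protocol.answerEntropy (S : Protocol.{u} G V) (σ : ℕ → Fin μ) (v : Fin μ)
    (t : ℕ) (j : Fin n) (q : S.QAlph) : ℝ :=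
  uniformCondEntropy (fun W : Fin f → Fin S.β → Fin k → F => S.answerFun v j q (stored G W j))
    (fun W (i : Fin t) => evaluation V W (σ i))

/-- The joint entropy of all answers to the queries `q`, given the evaluations of the first `t`
functions selected by `σ`. -/
noncomputable def Protocol.answersEntropy (S : Protocol.{u} G V) (σ : ℕ → Fin μ) (v : Fin μ)
    (t : ℕ) (q : Fin n → S.QAlph) : ℝ :=
  uniformCondEntropy
    (fun (W : Fin f → Fin S.β → Fin k → F) j => S.answerFun v j (q j) (stored G W j))
    (fun W (i : Fin t) => evaluation V W (σ i))

/-- The sum over the databases of the conditional entropies of their answers, given their queries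
and the evaluations of the first `t` functions selected by `σ`. -/
noncomputable def Protocol.totalEntropy (S : Protocol.{u} G V) (σ : ℕ → Fin μ) (v : Fin μ)
    (t : ℕ) : ℝ≥0∞ :=
  ∑ j, ∑' ω, S.P ω * ENNReal.ofReal (S.answerEntropy σ v t j (S.Q v j ω))

variable (S : Protocol.{u} G V) (σ : ℕ → Fin μ)

lemma Protocol.answerEntropy_nonneg (v : Fin μ) (t : ℕ) (j : Fin n) (q : S.QAlph) :
    0 ≤ S.answerEntropy σ v t j q := uniformCondEntropy_nonneg _ _

lemma Protocol.indep_query (v : Fin μ) (j : Fin n) : Indep S.P (S.Q v j) S.W :=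
  (S.indep v).comp_left fun q => q j

/-- Writes all databases over a common ω, so that their queries can be treated jointly. -/
lemma Protocol.totalEntropy_eq_tsum (v : Fin μ) (t : ℕ) : S.totalEntropy σ v t =
    ∑' ω, S.P ω * ENNReal.ofReal (∑ j, S.answerEntropy σ v t j (S.Q v j ω)) := by
  unfold totalEntropy
  rw [← Summable.tsum_finsetSum fun _ _ => ENNReal.summable]
  refine tsum_congr fun ω => ?_
  rw [ENNReal.ofReal_sum_of_nonneg fun j _ => S.answerEntropy_nonneg σ v t j _, Finset.mul_sum]

/-- By privacy, the total entropy does not depend on the desired function. -/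
lemma Protocol.totalEntropy_eq (v v' : Fin μ) (t : ℕ) :
    S.totalEntropy σ v t = S.totalEntropy σ v' t := by
  unfold totalEntropy
  refine Finset.sum_congr rfl fun j _ => ?_
  have hQ : S.P.map (S.Q v j) = S.P.map (S.Q v' j) := by
    have := congrArg (PMF.map Prod.fst) (S.privacy v v' j)
    rwa [PMF.map_comp, PMF.map_comp] at this
  rw [← tsum_map_mul S.P (S.Q v j) fun q => ENNReal.ofReal (S.answerEntropy σ v t j q),
    ← tsum_map_mul S.P (S.Q v' j) fun q => ENNReal.ofReal (S.answerEntropy σ v' t j q), ← hQ]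
  refine tsum_congr fun q => ?_
  by_cases hq : (S.P.map (S.Q v j)) q = 0
  · simp [hq]
  congr 2
  have hmap : ∀ v v', (S.P.map fun ω => (S.Q v j ω, (S.A v j ω,
      fun i : Fin t => evaluation V (S.W ω) (σ i)))) = S.P.map fun ω => (S.Q v' j ω,
        (S.A v' j ω, fun i : Fin t => evaluation V (S.W ω) (σ i))) := by
    intro v v'
    have := congrArg (PMF.map fun z : S.QAlph × S.AAlph × (Fin μ → Fin S.β → Fin k → F) =>
      (z.1, z.2.1, fun i : Fin t => z.2.2 (σ i))) (S.privacy v v' j)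
    rwa [PMF.map_comp, PMF.map_comp] at this
  -- The entropy of the evaluations is subtracted on both sides, so only the joint entropies with
  -- the answer are compared.
  refine congrArg (· - _) (uniformEntropy_eq_of_fiberCard_eq fun s => ?_)
  exact fiberCard_eq_of_map_eq S.uniform (S.indep_query v j) (S.indep_query v' j)
    (g := fun q W => (S.answerFun v j q (stored G W j), fun i : Fin t => evaluation V W (σ i)))
    (g' := fun q W => (S.answerFun v' j q (stored G W j), fun i : Fin t => evaluation V W (σ i)))
    (fun ω hω => by rw [S.answer_eq v j hω]) (fun ω hω => by rw [S.answer_eq v' j hω])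
    (hmap v v') hQ hq s

/-! ### The recursion in the number of known evaluations. -/

lemma Protocol.answersEntropy_le_sum (v : Fin μ) (t : ℕ) (q : Fin n → S.QAlph) :
    S.answersEntropy σ v t q ≤ ∑ j, S.answerEntropy σ v t j (q j) :=
  uniformCondEntropy_pi_le
    (fun j (W : Fin f → Fin S.β → Fin k → F) => S.answerFun v j (q j) (stored G W j)) _

lemma Protocol.div_mul_sum_le_answersEntropy (hG : IsMDSPIRCapacityAchieving G) (hk : 0 < k)
    (v : Fin μ) (t : ℕ) (q : Fin n → S.QAlph) :
    (k : ℝ) / n * ∑ j, S.answerEntropy σ v t j (q j) ≤ S.answersEntropy σ v t q :=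
  hG.div_mul_sum_le hk fun _ hI =>
    hI.sum_uniformCondEntropy_le V (fun i : Fin t => σ i) fun j => S.answerFun v j (q j)

/-- Both messages occur with the queries of ω at support points, where recovery applies. -/
lemma Protocol.evaluation_eq_of_answers_eq (v : Fin μ) {ω : S.Ω} (hω : ω ∈ S.P.support)
    {W W' : Fin f → Fin S.β → Fin k → F}
    (h : ∀ j, S.answerFun v j (S.Q v j ω) (stored G W j) =
      S.answerFun v j (S.Q v j ω) (stored G W' j)) :
    evaluation V W v = evaluation V W' v := by
  obtain ⟨ω₁, hω₁, hQ₁, rfl⟩ := (S.indep v).exists_mem_support S.uniform hω W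
  obtain ⟨ω₂, hω₂, hQ₂, rfl⟩ := (S.indep v).exists_mem_support S.uniform hω W'
  refine eq_of_condEntropy_eq_zero (X := fun ω => evaluation V (S.W ω) v)
    Fintype.one_lt_card (S.recovery v) hω₁ hω₂ ?_
  refine Prod.ext (funext fun j => ?_) (hQ₁.trans hQ₂.symm)
  have h1 := congrFun hQ₁ j
  have h2 := congrFun hQ₂ j
  simp only at h1 h2 ⊢
  rw [S.answer_eq v j hω₁, S.answer_eq v j hω₂, h1, h2, h j]

/-- Recovering one more independent function evaluation. -/
lemma Protocol.answersEntropy_succ {t : ℕ} (ht : LinearIndependent F fun i : Fin t => V (σ i))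
    (ht' : LinearIndependent F fun i : Fin (t + 1) => V (σ i)) {ω : S.Ω}
    (hω : ω ∈ S.P.support) :
    S.answersEntropy σ (σ t) t (fun j => S.Q (σ t) j ω) =
      (S.β * k : ℕ) * Real.log (Fintype.card F) +
        S.answersEntropy σ (σ t) (t + 1) (fun j => S.Q (σ t) j ω) := by
  have h1 := uniformEntropy_evaluation (β := S.β) (k := k) V (σ := fun i : Fin t => σ i) ht
  have h2 := uniformEntropy_evaluation (β := S.β) (k := k) V (σ := fun i : Fin (t + 1) => σ i) ht'
  simp only [Fintype.card_fin] at h1 h2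
  unfold answersEntropy uniformCondEntropy
  rw [h1, h2]
  -- The answers already determine evaluation `σ t`, so adjoining it leaves the joint entropy
  -- unchanged; only the subtracted term grows, by βk log q.
  have h3 : uniformEntropy (fun W : Fin f → Fin S.β → Fin k → F =>
      ((fun j => S.answerFun (σ t) j (S.Q (σ t) j ω) (stored G W j)),
        fun i : Fin t => evaluation V W (σ i))) =
      uniformEntropy (fun W : Fin f → Fin S.β → Fin k → F =>
      ((fun j => S.answerFun (σ t) j (S.Q (σ t) j ω) (stored G W j)),
        fun i : Fin (t + 1) => evaluation V W (σ i))) := by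
    refine uniformEntropy_congr fun W W' => ?_
    simp only [Prod.mk.injEq]
    refine and_congr_right fun h => ?_
    have h4 := S.evaluation_eq_of_answers_eq (σ t) hω (congrFun h)
    rw [funext_iff, funext_iff, Fin.forall_fin_succ']
    simp [h4]
  rw [h3]
  push_cast
  ring

lemma Protocol.le_totalEntropy_of_succ (hG : IsMDSPIRCapacityAchieving G) (hk : 0 < k) {t : ℕ}
    (ht : LinearIndependent F fun i : Fin t => V (σ i))
    (ht' : LinearIndependent F fun i : Fin (t + 1) => V (σ i)) (v : Fin μ) :
    ENNReal.ofReal ((S.β * k : ℕ) * Real.log (Fintype.card F)) +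
      ENNReal.ofReal ((k : ℝ) / n) * S.totalEntropy σ v (t + 1) ≤ S.totalEntropy σ v t := by
  have hlog : 0 ≤ Real.log (Fintype.card F) := Real.log_natCast_nonneg _
  -- Privacy allows the desired function to be `σ t`, the first one not yet conditioned on.
  rw [S.totalEntropy_eq σ v (σ t) (t + 1), S.totalEntropy_eq σ v (σ t) t,
    totalEntropy_eq_tsum, totalEntropy_eq_tsum, ← ENNReal.tsum_mul_left]
  set c := ENNReal.ofReal ((S.β * k : ℕ) * Real.log (Fintype.card F)) with hc
  have h1 : c = ∑' ω, S.P ω * c := by rw [ENNReal.tsum_mul_right, PMF.tsum_coe, one_mul]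
  rw [h1, ← ENNReal.tsum_add]
  refine ENNReal.tsum_le_tsum fun ω => ?_
  by_cases hω : ω ∈ S.P.support
  · rw [mul_left_comm, ← mul_add, ← ENNReal.ofReal_mul (by positivity), hc,
      ← ENNReal.ofReal_add (by positivity) (mul_nonneg (by positivity)
        (Finset.sum_nonneg fun j _ => S.answerEntropy_nonneg σ _ _ j _))]
    gcongr
    have h2 := S.div_mul_sum_le_answersEntropy σ hG hk (σ t) (t + 1) fun j => S.Q (σ t) j ω
    have h3 := S.answersEntropy_succ σ ht ht' hω
    have h4 := S.answersEntropy_le_sum σ (σ t) t fun j => S.Q (σ t) j ω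
    linarith
  · have : S.P ω = 0 := by simpa using hω
    simp [this]

/-- Induction runs backwards from t = r, where the bound is 0. -/
lemma Protocol.le_totalEntropy (hG : IsMDSPIRCapacityAchieving G) (hk : 0 < k) {r : ℕ}
    (hσ : ∀ t ≤ r, LinearIndependent F fun i : Fin t => V (σ i)) (v : Fin μ) (m : ℕ)
    (hm : m ≤ r) :
    ENNReal.ofReal ((S.β * k : ℕ) * Real.log (Fintype.card F) *
      ∑ i ∈ Finset.range m, ((k : ℝ) / n) ^ i) ≤ S.totalEntropy σ v (r - m) := by
  have hlog : 0 ≤ Real.log (Fintype.card F) := Real.log_natCast_nonneg _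
  induction m with
  | zero => simp
  | succ m ih =>
    have h1 := S.le_totalEntropy_of_succ σ hG hk (hσ (r - (m + 1)) (Nat.sub_le _ _))
      (hσ (r - (m + 1) + 1) (by omega)) v
    rw [show r - (m + 1) + 1 = r - m by omega] at h1
    refine le_trans ?_ (le_trans (add_le_add_right (mul_le_mul_right (ih (by omega)) _) _) h1)
    rw [← ENNReal.ofReal_mul (by positivity), ← ENNReal.ofReal_add (by positivity) (by positivity)]
    refine ENNReal.ofReal_le_ofReal (le_of_eq ?_)
    rw [Finset.sum_range_succ', mul_add, pow_zero, mul_one, add_comm]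
    simp only [pow_succ, ← Finset.sum_mul]
    ring

lemma Protocol.totalEntropy_zero_le (v : Fin μ) :
    S.totalEntropy σ v 0 ≤
      ENNReal.ofReal (Real.log (Fintype.card F)) * S.downloadCost v := by
  have hlog : 0 < Real.log (Fintype.card F) :=
    Real.log_pos (by exact_mod_cast Fintype.one_lt_card)
  unfold totalEntropy downloadCost
  rw [Finset.mul_sum]
  refine Finset.sum_le_sum fun j _ => ?_
  refine le_trans ?_ (mul_le_mul_right ((S.indep_query v j).tsum_uniformEntropy_le_entropy
    S.uniform (A := S.A v j) (g := fun q W => S.answerFun v j q (stored G W j))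
    fun ω hω => S.answer_eq v j hω) _)
  rw [← ENNReal.tsum_mul_left]
  refine ENNReal.tsum_le_tsum fun ω => ?_
  rw [mul_left_comm, ← ENNReal.ofReal_mul hlog.le, mul_div_cancel₀ _ hlog.ne']
  gcongr
  unfold answerEntropy uniformCondEntropy
  refine (sub_le_self _ (uniformEntropy_nonneg _)).trans (uniformEntropy_mono fun W W' h => ?_)
  exact Prod.ext h (funext fun i => i.elim0)

lemma Hmin_le_one (v : Fin μ) : Hmin V ≤ 1 :=
  (iInf_le _ v).trans (entropy_le_one _ _)

lemma Protocol.rate_le (hG : IsMDSPIRCapacityAchieving G) (hk : 0 < k) (hV : 0 < V.rank)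
    (v : Fin μ) :
    S.rate v ≤ ENNReal.ofReal (1 / ∑ i ∈ Finset.range V.rank, ((k : ℝ) / n) ^ i) := by
  have hlog : 0 < Real.log (Fintype.card F) :=
    Real.log_pos (by exact_mod_cast Fintype.one_lt_card)
  obtain ⟨σ, hσ⟩ := exists_linearIndependent_rows V v
  set s := ∑ i ∈ Finset.range V.rank, ((k : ℝ) / n) ^ i with hs
  have hs0 : 0 < s := by
    refine Finset.sum_pos' (fun i _ => by positivity) ⟨0, Finset.mem_range.2 hV, by simp⟩
  have h1 := (S.le_totalEntropy σ hG hk hσ v V.rank le_rfl).trans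
    (Nat.sub_self V.rank ▸ S.totalEntropy_zero_le σ v)
  -- Cancels log q, passing from natural to q-ary units.
  rw [← hs, mul_right_comm, mul_comm, ENNReal.ofReal_mul hlog.le,
    ENNReal.mul_le_mul_iff_right (by simpa using hlog) ENNReal.ofReal_ne_top] at h1
  refine ENNReal.div_le_of_le_mul ?_
  calc ((S.β * k : ℕ) : ℝ≥0∞) * Hmin V ≤ ((S.β * k : ℕ) : ℝ≥0∞) * 1 := by
        gcongr
        exact Hmin_le_one v
    _ = ENNReal.ofReal (1 / s) * ENNReal.ofReal ((S.β * k : ℕ) * s) := by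
        rw [← ENNReal.ofReal_mul (by positivity), mul_one, mul_left_comm,
          one_div_mul_cancel hs0.ne', mul_one, ENNReal.ofReal_natCast]
    _ ≤ _ := by gcongr

end Converse

end PLC

theorem theorem3 {F : Type w} [Field F] [Fintype F] {n k f μ : ℕ} (hk : 0 < k)
    (G : Matrix (Fin k) (Fin n) F) (hG : LinearIndependent F G.row)
    (hcode : PLC.IsMDSPIRCapacityAchieving G)
    (V : Matrix (Fin μ) (Fin f) F) (hV : V ≠ 0) :
    PLC.capacity.{u} G V ≤
        ENNReal.ofReal (1 / (1 + ∑ v ∈ Finset.Icc 1 (V.rank - 1), ((k : ℝ) / n) ^ v)) ∧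
      (k < n →
        1 / (1 + ∑ v ∈ Finset.Icc 1 (V.rank - 1), ((k : ℝ) / n) ^ v) =
          (1 - (k : ℝ) / n) * (1 - ((k : ℝ) / n) ^ V.rank)⁻¹) := by
  have hr : 0 < V.rank := by
    refine Nat.pos_of_ne_zero fun h => hV ?_
    have h0 := LinearMap.range_eq_bot.1 (Submodule.finrank_eq_zero.1 h)
    exact Matrix.toLin'.injective (h0.trans (map_zero _).symm)
  -- The leading 1 is the term of exponent 0, present because the rank is positive.
  have hs : 1 + ∑ v ∈ Finset.Icc 1 (V.rank - 1), ((k : ℝ) / n) ^ v =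
      ∑ v ∈ Finset.range V.rank, ((k : ℝ) / n) ^ v := by
    obtain ⟨m, hm⟩ := Nat.exists_eq_succ_of_ne_zero hr.ne'
    rw [hm, Nat.succ_eq_add_one, Nat.add_sub_cancel, ← Finset.sum_erase_add _ _
      (Finset.mem_range.2 (Nat.succ_pos m)), pow_zero, add_comm]
    congr 2
    ext i
    simp only [Finset.mem_Icc, Finset.mem_erase, Finset.mem_range]
    omega
  rw [hs]
  refine ⟨iSup₂_le fun S v => S.rate_le hcode hk hr v, fun hkn => ?_⟩
  have hlt : (k : ℝ) / n < 1 := by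
    rw [div_lt_one (by exact_mod_cast hk.trans hkn)]
    exact_mod_cast hkn
  rw [geom_sum_eq hlt.ne, one_div_div, ← neg_sub, ← neg_sub 1 (((k : ℝ) / n) ^ V.rank), neg_div_neg_eq,
    div_eq_mul_inv]
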